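/- Lemma 4.2 (lemma:chain_map_surjective). Let $n\ge 2$, let $D$ be a disk with marked points $z_1,\dots,z_n$ in a row, and let $a_1,\dots,a_{n-1}$ be disjoint properly embedded arcs such that $a_i$ separates $z_1,\dots,z_i$ from $z_{i+1},\dots,z_n$. Let $b_i$ be obtained from $a_i$ by pushing its endpoints along $\partial D$, so that $a_i$ and $b_i$ cross transversely in one point and $a_i\cap b_j=\emptyset$ for $i\neq j$. For a mapping class $\phi$ of the $n$-punctured disk (that is, an $n$-strand braid), the *braid diagram* $\mathcal H_\phi$ consists of the sphere $D\cup -D'$, where $D'$ is a second copy of $D$ with copies $a_i'$, $b_i'$ of $a_i$, $b_i$, the curves $\alpha_i=a_i\cup a_i'$ and $\beta_i=b_i\cup\phi(b_i')$ (made transverse), and the base points $z_i\in D$. We assume that the union of all $\alpha$ and $\beta$ curves of $\mathcal H_\phi$ is connected; equivalently, all complementary regions are disks. Let $\mathcal H=(\Sigma,\boldsymbol\alpha,\boldsymbol\beta)$ be obtained from $\mathcal H_\phi$ by finitely many moves of the following two kinds, such that all regions remain disks; this includes the nice braid diagrams $\mathcal H^{nice}_w$, where $w$ is a braid word for $\phi$.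 * Stabilization: attach a 1-handle to the surface, and add a new curve $\widehat\beta$, a belt of the handle that meets no other $\beta$ or old $\alpha$ curve, and a new curve $\widehat\alpha$, disjoint from the other $\alpha$ curves, that runs over the handle once (so that $|\widehat\alpha\cap\widehat\beta|=1$). * Finger move: push a piece of a curve of one family across a piece of a curve of the other family by an isotopy that creates one bigon with two new intersection points. So $\Sigma$ is a closed oriented surface of some genus $g$ with curves $\alpha_1,\dots,\alpha_{n-1+g}$ and $\beta_1,\dots,\beta_{n-1+g}$. Let $z_1,\dots,z_n$ be base points off the curves such that every component of $\Sigma\setminus\boldsymbol\alpha$ and every component of $\Sigma\setminus\boldsymbol\beta$ contains exactly one of them. Let $R$ be the real vector space with basis the elementary regions, i.e. the components of $\Sigma\setminus(\boldsymbol\alpha\cup\boldsymbol\beta)$, let $C$ be the real vector space with basis all the $\alpha$ curves and all but one (arbitrarily chosen) of the $\beta$ curves, and let $V$ be the real vector space with basis the vertices, i.e. the points of $\boldsymbol\alpha\cap\boldsymbol\beta$. Let $\mathcal D:R\oplus C\to V$ be the linear map that sends a region $r$ to the signed sum of the vertices at its corners, where a corner is positive if, traveling along $\partial r$ in the direction induced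 by the orientation, one jumps there from a $\beta$ curve to an $\alpha$ curve, and negative otherwise, and that sends a curve to the sum of the vertices along it. Let $A_i,B_i\in R$ be the sums of the elementary regions contained in the component of $\Sigma\setminus\boldsymbol\alpha$, respectively $\Sigma\setminus\boldsymbol\beta$, that contains $z_i$. Then $\mathcal D$ is surjective, and its kernel is spanned by $A_1,\dots,A_n$ and $B_1,\dots,B_{n-1}$. -/

import Mathlib

noncomputable section

open scoped Classical

/-- A pair of transverse families `α`, `β` of disjoint simple closed curves that cut a closed
connected oriented surface `Σ` into discs, recorded as a combinatorial map.

The vertices are the points of `α ∩ β`. The four ends of edges (darts) at a vertex `v` are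
`(v, 0), (v, 1), (v, 2), (v, 3)` in counterclockwise order; those with even second entry run along
the `α` curve through `v`, those with odd second entry along the `β` curve through `v`.
`edge d` is the other end of the edge that starts with the dart `d`. Gluing a disc to
every boundary walk gives back `Σ`. -/
structure CurveDiagram where
  /-- the number of vertices -/
  verts : ℕ
  edge : Fin verts × ZMod 4 → Fin verts × ZMod 4
  edge_edge : ∀ d, edge (edge d) = d
  edge_ne : ∀ d, edge d ≠ d
  /-- an edge runs along an `α` curve at both ends or along a `β` curve at both ends -/
  edge_parity : ∀ d, (edge d).2 = d.2 ∨ (edge d).2 = d.2 + 2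
  /-- the union of all curves (equivalently, the surface) is connected -/
  connected : ∀ d d' : Fin verts × ZMod 4,
    Relation.EqvGen (fun x y => y = edge x ∨ y = (x.1, x.2 + 1)) d d'

namespace CurveDiagram

variable (H : CurveDiagram)

abbrev Vertex : Type := Fin H.verts

/-- Darts. The dart `(v, k)` also names the corner at `v` between the darts `(v, k)` and
`(v, k + 1)`, which is the corner on the left of the dart `(v, k)` when leaving `v`. -/
abbrev Dart : Type := H.Vertex × ZMod 4

variable {H} in
/-- The dart on the other side of the vertex, on the same curve. -/
def opp (d : H.Dart) : H.Dart := (d.1, d.2 + 2)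

/-- A dart that runs along an `α` curve. -/
def IsAlphaDart (d : H.Dart) : Prop := d.2 = 0 ∨ d.2 = 2

/-- The curves: follow edges, and go straight ahead at every vertex. -/
def Curve : Type := Quot (fun d d' : H.Dart => d' = H.edge d ∨ d' = opp d)

variable {H} in
def curve (d : H.Dart) : H.Curve := Quot.mk _ d

variable {H} in
/-- The `α` curve through a vertex. -/
def alphaCurve (v : H.Vertex) : H.Curve := curve ((v, 0) : H.Dart)

variable {H} in
/-- The `β` curve through a vertex. -/
def betaCurve (v : H.Vertex) : H.Curve := curve ((v, 1) : H.Dart)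

def IsBeta (c : H.Curve) : Prop := ∃ v : H.Vertex, betaCurve v = c

/-- Walking along the boundary of a region with the region on the left, one leaves the vertex of
the corner `d` along the dart `d`, arrives at the next vertex along the dart `edge d`, and the
corner met there is the one on the clockwise side of that dart. -/
def nextCorner (d : H.Dart) : H.Dart := ((H.edge d).1, (H.edge d).2 - 1)

/-- The elementary regions, that is, the components of `Σ ∖ (α ∪ β)`: cyclic sequences of
corners. -/
def Region : Type := Quot (fun d d' : H.Dart => d' = H.nextCorner d)

variable {H} in
/-- The region at a corner. -/
def region (d : H.Dart) : H.Region := Quot.mk _ d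

instance : Finite H.Region := inferInstanceAs (Finite (Quot _))

instance : Fintype H.Region := Fintype.ofFinite _

/-- The Euler characteristic of the surface; there are `2 * verts` edges. -/
def eulerChar : ℤ := (H.verts : ℤ) - 2 * H.verts + Nat.card H.Region

/-- The components of `Σ ∖ α`: regions on the two sides of an edge of a `β` curve are in the same
component. -/
def AlphaComponent : Type :=
  Quot (fun r r' : H.Region => ∃ d : H.Dart, ¬ H.IsAlphaDart d ∧
    r = region d ∧ r' = region (H := H) (d.1, d.2 - 1))

/-- The components of `Σ ∖ β`. -/
def BetaComponent : Type :=
  Quot (fun r r' : H.Region => ∃ d : H.Dart, H.IsAlphaDart d ∧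
    r = region d ∧ r' = region (H := H) (d.1, d.2 - 1))

variable {H} in
def alphaComponent (r : H.Region) : H.AlphaComponent := Quot.mk _ r

variable {H} in
def betaComponent (r : H.Region) : H.BetaComponent := Quot.mk _ r

/-- Every component of `Σ ∖ α` and every component of `Σ ∖ β` contains exactly one of the base
points `z i`, where `z i` is recorded by the region that contains it. -/
def IsBasepoints {n : ℕ} (z : Fin n → H.Region) : Prop :=
  Function.Bijective (fun i => alphaComponent (z i)) ∧
    Function.Bijective (fun i => betaComponent (z i))

/-! ### The linear map -/

/-- The sign of a corner: walking along the boundary of the region with the region on the left,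
one arrives along the dart `(v, k + 1)` and leaves along the dart `(v, k)`; the sign is positive
when this jumps from a `β` curve to an `α` curve. -/
def cornerSign (d : H.Dart) : ℝ := if H.IsAlphaDart d then 1 else -1

/-- The signed sum of the vertices at the corners of a region. -/
def regionImage (r : H.Region) : H.Vertex →₀ ℝ :=
  ∑ d : H.Dart with region d = r, Finsupp.single d.1 (H.cornerSign d)

/-- The sum of the vertices along a curve. -/
def curveImage (c : H.Curve) : H.Vertex →₀ ℝ :=
  ∑ v : H.Vertex with alphaCurve v = c ∨ betaCurve v = c, Finsupp.single v 1

/-- The map `𝒟 : R ⊕ C → V`, where `R` has the regions as a basis, `C` has all `α` curves and all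
`β` curves but `b` as a basis, and `V` has the vertices as a basis. -/
def vertexMap (b : H.Curve) :
    (H.Region →₀ ℝ) × ({c : H.Curve // c ≠ b} →₀ ℝ) →ₗ[ℝ] (H.Vertex →₀ ℝ) :=
  (Finsupp.linearCombination ℝ H.regionImage).coprod
    (Finsupp.linearCombination ℝ (fun c : {c : H.Curve // c ≠ b} => H.curveImage c.1))

/-- The sum of the regions in the component of `Σ ∖ α` that contains the region `r`. -/
def alphaDomain (r : H.Region) : H.Region →₀ ℝ :=
  ∑ s : H.Region with alphaComponent s = alphaComponent r, Finsupp.single s 1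

/-- The sum of the regions in the component of `Σ ∖ β` that contains the region `r`. -/
def betaDomain (r : H.Region) : H.Region →₀ ℝ :=
  ∑ s : H.Region with betaComponent s = betaComponent r, Finsupp.single s 1

/-! ### Braid diagrams, stabilizations and finger moves -/

/-- Braid diagrams on `m + 1` strands: `Σ = D ∪ -D'` is a sphere, with `m` curves
`α i = a i ∪ a' i` and `m` curves `β i = b i ∪ b' i`. In the disc `D`, from left to right, lie
`z 0, x 0, z 1, x 1, …, x (m - 1), z m`, where `x i` is the only point of `a i ∩ b i` and there are
no other intersection points in `D`; so one corner at `x i` belongs to the region of `z i` and the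
opposite corner to the region of `z (i + 1)`. Conversely, these corners determine `D` as a
neighbourhood of a chain of arcs that joins the points in this order. The arcs `b'` in the
complementary disc `D'` are arbitrary: they are the images `φ (b i)` for an arbitrary mapping class
`φ` of the punctured disc. The base points `w` play no role here (one can always choose them,
for instance close to the points `z`), and neither does the side to which `b i` is pushed off. -/
def IsBraidDiagram (m : ℕ) : Prop :=
  H.eulerChar = 2 ∧
  ∃ (x : Fin m → H.Vertex) (z : Fin (m + 1) → H.Region),
    (∀ v : H.Vertex, ∃! i, alphaCurve v = alphaCurve (x i)) ∧
    (∀ v : H.Vertex, ∃! i, betaCurve v = betaCurve (x i)) ∧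
    H.IsBasepoints z ∧
    ∀ i : Fin m, ∃ k : ZMod 4,
      region (H := H) (x i, k) = z i.castSucc ∧ region (H := H) (x i, k + 2) = z i.succ

/-- `H.Trace S d d'`: leaving along the dart `d` and going straight ahead at the vertices in `S`,
one can arrive along the dart `d'`. -/
inductive Trace (S : Set H.Vertex) (d : H.Dart) : H.Dart → Prop
  | edge : Trace S d (H.edge d)
  | through (x : H.Dart) : Trace S d x → x.1 ∈ S → Trace S d (H.edge (opp x))

/-- `H` is obtained from `H'` by forgetting the vertices of `H'` outside the image of `ι`: at a
forgotten vertex, each strand that is still present runs straight ahead. -/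
def IsErasure (H H' : CurveDiagram) (ι : H.Vertex → H'.Vertex) : Prop :=
  Function.Injective ι ∧
  ∀ d : H.Dart, H'.Trace (Set.range ι)ᶜ (ι d.1, d.2) (ι (H.edge d).1, (H.edge d).2)

/-- `H'` is a stabilization of `H`: a 1-handle is attached to the surface, which lowers the Euler
characteristic by `2`; the new `β` curve `b` is a belt of the handle, and the new `α` curve `a`
runs over the handle once and then returns, across `β` curves, in the complement of the other `α`
curves. So `b` meets `a` in one point and meets no other curve. Deleting `a` and `b`, and capping
off with discs, gives `H`. -/
def IsStabilization (H H' : CurveDiagram) : Prop :=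
  H'.eulerChar = H.eulerChar - 2 ∧
  ∃ (a b : H'.Curve) (ι : H.Vertex → H'.Vertex),
    (∃! v, betaCurve v = b) ∧
    (∀ v, betaCurve v = b → alphaCurve v = a) ∧
    IsErasure H H' ι ∧
    (∀ v, v ∈ Set.range ι ↔ alphaCurve v ≠ a) ∧
    (∀ v, betaCurve v = b ∨ ∃ u, betaCurve (ι u) = betaCurve v)

/-- `H'` is obtained from `H` by a finger move: a piece of a curve is pushed across a piece of
another one, through a region that lies between them, which creates a bigon with two new vertices
`p` and `q`. The surface and the set of curves do not change. -/
def IsFingerMove (H H' : CurveDiagram) : Prop :=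
  H'.eulerChar = H.eulerChar ∧
  ∃ (p q : H'.Vertex) (ι : H.Vertex → H'.Vertex),
    p ≠ q ∧
    (∃ k l : ZMod 4, H'.nextCorner (p, k) = (q, l) ∧ H'.nextCorner (q, l) = (p, k)) ∧
    IsErasure H H' ι ∧
    (∀ v, v ∈ Set.range ι ↔ v ≠ p ∧ v ≠ q) ∧
    (∀ v, ∃ u, alphaCurve (ι u) = alphaCurve v) ∧
    (∀ v, ∃ u, betaCurve (ι u) = betaCurve v)

/-- The diagrams that arise from braid diagrams on `m + 1` strands by finitely many stabilizations
and finger moves. The nice braid diagrams, where each six-sided region is joined by a handle to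
the region of a base point and the belt curves are then pushed by finger moves, are among them. -/
inductive IsStabilizedBraidDiagram (m : ℕ) : CurveDiagram → Prop
  | braid (H : CurveDiagram) : H.IsBraidDiagram m → IsStabilizedBraidDiagram m H
  | stabilization (H H' : CurveDiagram) :
      IsStabilizedBraidDiagram m H → IsStabilization H H' → IsStabilizedBraidDiagram m H'
  | fingerMove (H H' : CurveDiagram) :
      IsStabilizedBraidDiagram m H → IsFingerMove H H' → IsStabilizedBraidDiagram m H'

end CurveDiagram

end

namespace CurveDiagram

open scoped Classical

variable {H : CurveDiagram}

/-! Let `(f, c)` be in the kernel. At each vertex the alternating sum of `f` over the four corners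
equals `-(c α + c β)`, where `α` and `β` are the curves through it. Weight the jump of `f` across
each dart by the coefficient of its curve and the sign of its type. The total over all darts is
zero, because the jump changes sign when an edge is reversed. Grouped by vertices, the same total is
`-∑ (c α + c β)²`. So `c α = -c β` at every vertex (`add_eq_zero_of_cornerSum_add`). Since the
diagram is connected and the omitted curve has coefficient zero, `c = 0`. The kernel is therefore
the space of periodic domains (`mem_ker_vertexMap`).

The `2m + 1` given domains are periodic and linearly independent (`linearIndependent_domains`), so
it suffices to show that periodic domains have dimension at most `2m + 1`. For a braid diagram this
holds because a periodic domain is determined by one jump per curve and one value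
(`finrank_periodicDomains_le`). Stabilizations and finger moves do not raise the dimension:
restriction to the corners at the old vertices is a well-defined injection into the periodic domains
of the old diagram (`finrank_periodicDomains_le_of_erasure`).

Surjectivity follows by rank-nullity. There are `χ + verts` regions, so the rank is at least `verts`
as soon as `χ + #curves ≥ 2m + 2`. This bound survives the moves: a stabilization lowers `χ` by two
and adds at least two curves. -/

instance : Finite H.Curve := inferInstanceAs (Finite (Quot _))

noncomputable instance : Fintype H.Curve := Fintype.ofFinite _

/-! ### Darts and curves -/

lemma opp_opp (d : H.Dart) : opp (opp d) = d := by
  obtain ⟨v, k⟩ := d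
  simp only [opp, Prod.mk.injEq, true_and]
  revert k
  decide

lemma curve_edge (d : H.Dart) : curve (H.edge d) = curve d :=
  (Quot.sound (r := fun d d' : H.Dart => d' = H.edge d ∨ d' = opp d) (Or.inl rfl)).symm

lemma curve_opp (d : H.Dart) : curve (opp d) = curve d :=
  (Quot.sound (r := fun d d' : H.Dart => d' = H.edge d ∨ d' = opp d) (Or.inr rfl)).symm

lemma isAlphaDart_add_two (v : H.Vertex) (k : ZMod 4) :
    H.IsAlphaDart (v, k + 2) ↔ H.IsAlphaDart (v, k) := by
  simp only [IsAlphaDart]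
  revert k
  decide

lemma isAlphaDart_add_one (v : H.Vertex) (k : ZMod 4) :
    H.IsAlphaDart (v, k + 1) ↔ ¬ H.IsAlphaDart (v, k) := by
  simp only [IsAlphaDart]
  revert k
  decide

lemma isAlphaDart_opp (d : H.Dart) : H.IsAlphaDart (opp d) ↔ H.IsAlphaDart d :=
  isAlphaDart_add_two d.1 d.2

lemma isAlphaDart_edge (d : H.Dart) : H.IsAlphaDart (H.edge d) ↔ H.IsAlphaDart d := by
  rcases H.edge_parity d with h | h
  · simp only [IsAlphaDart, h]
  · have := isAlphaDart_add_two d.1 d.2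
    simpa only [IsAlphaDart, h] using this

/-- A property of darts that is preserved along edges and straight ahead depends on the curve
only. -/
lemma of_curve_eq {p : H.Dart → Prop} (he : ∀ d, p d → p (H.edge d)) (ho : ∀ d, p d → p (opp d))
    {d d' : H.Dart} (h : curve d = curve d') (hd : p d) : p d' := by
  have key : ∀ x y : H.Dart, (y = H.edge x ∨ y = opp x) → p x = p y := by
    rintro x y (rfl | rfl)
    · refine propext ⟨he x, fun h => ?_⟩
      simpa only [H.edge_edge] using he _ h
    · refine propext ⟨ho x, fun h => ?_⟩
      simpa only [opp_opp] using ho _ h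
  have := congrArg (Quot.lift p key) h
  exact this.mp hd

lemma isAlphaDart_iff_of_curve_eq {d d' : H.Dart} (h : curve d = curve d') :
    H.IsAlphaDart d ↔ H.IsAlphaDart d' :=
  ⟨of_curve_eq (fun d => (isAlphaDart_edge d).2) (fun d => (isAlphaDart_opp d).2) h,
    of_curve_eq (fun d => (isAlphaDart_edge d).2) (fun d => (isAlphaDart_opp d).2) h.symm⟩

lemma isAlphaDart_zero (v : H.Vertex) : H.IsAlphaDart (v, 0) := Or.inl rfl

lemma isAlphaDart_two (v : H.Vertex) : H.IsAlphaDart (v, 2) := Or.inr rfl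

lemma not_isAlphaDart_one (v : H.Vertex) : ¬ H.IsAlphaDart (v, 1) := by
  simp only [IsAlphaDart]; decide

lemma not_isAlphaDart_three (v : H.Vertex) : ¬ H.IsAlphaDart (v, 3) := by
  simp only [IsAlphaDart]; decide

lemma alphaCurve_ne_betaCurve (v w : H.Vertex) : alphaCurve v ≠ betaCurve w := fun h =>
  not_isAlphaDart_one w ((isAlphaDart_iff_of_curve_eq h).1 (isAlphaDart_zero v))

lemma curve_of_isAlphaDart {d : H.Dart} (h : H.IsAlphaDart d) : curve d = alphaCurve d.1 := by
  obtain ⟨v, k⟩ := d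
  rcases h with h | h <;> simp only at h <;> subst h
  · rfl
  · exact curve_opp (v, 0)

lemma curve_of_not_isAlphaDart {d : H.Dart} (h : ¬ H.IsAlphaDart d) :
    curve d = betaCurve d.1 := by
  obtain ⟨v, k⟩ := d
  have : k = 1 ∨ k = 3 := by
    simp only [IsAlphaDart] at h
    revert k
    decide
  rcases this with h | h <;> subst h
  · rfl
  · exact curve_opp (v, 1)

/-- A property of darts that is preserved along edges and by rotation at a vertex is the same
for all darts. -/
lemma dart_induction {p : H.Dart → Prop} (he : ∀ d, p d → p (H.edge d))
    (hr : ∀ v k, p (v, k) ↔ p (v, k + 1)) (d d' : H.Dart) (hd : p d) : p d' := by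
  have key : ∀ x y, Relation.EqvGen (fun x y : H.Dart => y = H.edge x ∨ y = (x.1, x.2 + 1)) x y →
      (p x ↔ p y) := by
    intro x y h
    induction h with
    | rel x y h =>
      rcases h with rfl | rfl
      · refine ⟨he x, fun h => ?_⟩
        simpa only [H.edge_edge] using he _ h
      · exact hr x.1 x.2
    | refl x => exact Iff.rfl
    | symm x y _ ih => exact ih.symm
    | trans x y z _ _ ih₁ ih₂ => exact ih₁.trans ih₂
  exact (key d d' (H.connected d d')).1 hd

lemma region_nextCorner (d : H.Dart) :
    region (H := H) ((H.edge d).1, (H.edge d).2 - 1) = region d :=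
  (Quot.sound (r := fun d d' : H.Dart => d' = H.nextCorner d) rfl).symm

lemma region_edge (d : H.Dart) : region (H.edge d) = region (H := H) (d.1, d.2 - 1) := by
  have := region_nextCorner (H.edge d)
  rw [H.edge_edge] at this
  exact this.symm

lemma sum_dart (f : H.Dart → ℝ) :
    ∑ d, f d = ∑ v : H.Vertex, (f (v, 0) + f (v, 1) + f (v, 2) + f (v, 3)) := by
  rw [Fintype.sum_prod_type]
  refine Finset.sum_congr rfl fun v _ => ?_
  exact Fin.sum_univ_four (fun k : Fin 4 => f (v, k))

lemma sum_eq_zero_of_edge_neg {f : H.Dart → ℝ} (h : ∀ d, f (H.edge d) = -f d) :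
    ∑ d, f d = 0 := by
  refine Finset.sum_involution (fun d _ => H.edge d) (fun d _ => by rw [h]; ring)
    (fun d _ _ => H.edge_ne d) (fun _ _ => Finset.mem_univ _) (fun d _ => H.edge_edge d)

/-! ### Periodic domains -/

/-- The jump of a function on the regions across the edge that starts with the dart `d`. -/
def jump (r : H.Region → ℝ) (d : H.Dart) : ℝ := r (region d) - r (region (H := H) (d.1, d.2 - 1))

lemma jump_edge (r : H.Region → ℝ) (d : H.Dart) : jump r (H.edge d) = -jump r d := by
  rw [jump, jump, region_nextCorner, region_edge]
  ring

/-- The alternating sum of the values of a function at the corners at a vertex. -/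
def cornerSum (r : H.Region → ℝ) (v : H.Vertex) : ℝ :=
  r (region (v, 0)) - r (region (v, 1)) + r (region (v, 2)) - r (region (v, 3))

lemma jump_zero_add_jump_two (r : H.Region → ℝ) (v : H.Vertex) :
    jump r (v, 0) + jump r (v, 2) = cornerSum r v := by
  have h1 : (0 - 1 : ZMod 4) = 3 := by decide
  have h2 : (2 - 1 : ZMod 4) = 1 := by decide
  simp only [jump, cornerSum, h1, h2]
  ring

lemma jump_one_add_jump_three (r : H.Region → ℝ) (v : H.Vertex) :
    jump r (v, 1) + jump r (v, 3) = -cornerSum r v := by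
  have h1 : (1 - 1 : ZMod 4) = 0 := by decide
  have h2 : (3 - 1 : ZMod 4) = 2 := by decide
  simp only [jump, cornerSum, h1, h2]
  ring

variable (H) in
/-- The functions on the regions whose boundary is a combination of whole curves. -/
def periodicDomains : Submodule ℝ (H.Region → ℝ) where
  carrier := {r | ∀ v, cornerSum r v = 0}
  add_mem' {r s} hr hs v := by
    have h1 := hr v
    have h2 := hs v
    simp only [cornerSum, Pi.add_apply] at h1 h2 ⊢
    linarith
  zero_mem' v := by simp [cornerSum]
  smul_mem' t r hr v := by
    have h1 := hr v
    simp only [cornerSum, Pi.smul_apply, smul_eq_mul] at h1 ⊢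
    linear_combination t * h1

/-- A vanishing alternating corner sum means that the jump continues straight across the vertex. The
sign appears because `opp d` points backwards, which exchanges left and right. -/
lemma jump_opp {r : H.Region → ℝ} (hr : r ∈ H.periodicDomains) (d : H.Dart) :
    jump r (opp d) = -jump r d := by
  obtain ⟨v, k⟩ := d
  have h0 := jump_zero_add_jump_two r v
  have h1 := jump_one_add_jump_three r v
  rw [hr v] at h0 h1
  have h2 : (2 + 2 : ZMod 4) = 0 := by decide
  have h3 : (3 + 2 : ZMod 4) = 1 := by decide
  have h4 : (1 + 2 : ZMod 4) = 3 := by decide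
  have h5 : (0 + 2 : ZMod 4) = 2 := by decide
  have hk : k = 0 ∨ k = 1 ∨ k = 2 ∨ k = 3 := by revert k; decide
  rcases hk with rfl | rfl | rfl | rfl <;> simp only [opp, h2, h3, h4, h5] <;> linarith

lemma jump_eq_zero_of_curve_eq {r : H.Region → ℝ} (hr : r ∈ H.periodicDomains) {d d' : H.Dart}
    (h : curve d = curve d') (hd : jump r d = 0) : jump r d' = 0 :=
  of_curve_eq (p := fun d => jump r d = 0) (fun d hd => by rw [jump_edge, hd, neg_zero])
    (fun d hd => by rw [jump_opp hr, hd, neg_zero]) h hd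

lemma region_surjective : Function.Surjective (region (H := H)) := Quot.mk_surjective

/-- Connectedness joins any two corners by edges and rotations, and each such step at most crosses a
dart without a jump. -/
lemma eq_const_of_jump_eq_zero {r : H.Region → ℝ} (h : ∀ d, jump r d = 0) (s t : H.Region) :
    r s = r t := by
  obtain ⟨d, rfl⟩ := region_surjective s
  obtain ⟨d', rfl⟩ := region_surjective t
  refine (dart_induction (p := fun x => r (region d) = r (region x)) ?_ ?_ d d' rfl)
  · intro x hx
    rw [hx, region_edge]
    exact sub_eq_zero.1 (h x)
  · intro v k
    have := h (v, k + 1)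
    simp only [jump, add_sub_cancel_right] at this
    rw [sub_eq_zero.1 this]

/-- The jump on one dart of a curve determines, up to sign, the jumps along the whole curve. All
jumps together with one value determine the function. -/
lemma finrank_periodicDomains_le :
    Module.finrank ℝ H.periodicDomains ≤ Fintype.card H.Curve + 1 := by
  -- Without regions there is no place to evaluate, but then the space is zero.
  rcases isEmpty_or_nonempty H.Region with hR | ⟨⟨s⟩⟩
  · have : Module.finrank ℝ H.periodicDomains ≤ Module.finrank ℝ (H.Region → ℝ) :=
      Submodule.finrank_le _
    rw [Module.finrank_fintype_fun_eq_card, Fintype.card_eq_zero] at this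
    omega
  · let L : (H.Region → ℝ) →ₗ[ℝ] (H.Curve → ℝ) × ℝ :=
      { toFun r := (fun c => jump r (Quot.out c), r s)
        map_add' r t := by
          ext c
          · simp only [jump, Pi.add_apply, Prod.fst_add]; ring
          · rfl
        map_smul' x r := by
          ext c
          · simp only [jump, Pi.smul_apply, Prod.smul_fst, smul_eq_mul, RingHom.id_apply]; ring
          · rfl }
    have hL : Function.Injective (L ∘ₗ H.periodicDomains.subtype) := by
      rw [← LinearMap.ker_eq_bot, LinearMap.ker_eq_bot']
      rintro ⟨r, hr⟩ h
      have h1 : ∀ c : H.Curve, jump r (Quot.out c) = 0 := fun c => congrFun (congrArg Prod.fst h) c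
      have h2 : r s = 0 := congrArg Prod.snd h
      ext t
      have := eq_const_of_jump_eq_zero (r := r) (fun d =>
        jump_eq_zero_of_curve_eq hr (d := Quot.out (curve d)) (Quot.out_eq _) (h1 _)) t s
      simp [this, h2]
    have := LinearMap.finrank_le_finrank_of_injective hL
    simpa using this

/-! ### The kernel of the linear map -/

lemma cornerSign_edge (d : H.Dart) : H.cornerSign (H.edge d) = H.cornerSign d := by
  simp only [cornerSign, isAlphaDart_edge]

lemma cornerSign_zero (v : H.Vertex) : H.cornerSign (v, 0) = 1 := if_pos (isAlphaDart_zero v)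

lemma cornerSign_one (v : H.Vertex) : H.cornerSign (v, 1) = -1 := if_neg (not_isAlphaDart_one v)

lemma cornerSign_two (v : H.Vertex) : H.cornerSign (v, 2) = 1 := if_pos (isAlphaDart_two v)

lemma cornerSign_three (v : H.Vertex) : H.cornerSign (v, 3) = -1 :=
  if_neg (not_isAlphaDart_three v)

lemma linearCombination_regionImage (f : H.Region →₀ ℝ) (v : H.Vertex) :
    Finsupp.linearCombination ℝ H.regionImage f v = cornerSum f v := by
  have h1 : Finsupp.linearCombination ℝ H.regionImage f v =
      ∑ d : H.Dart, if d.1 = v then f (region d) * H.cornerSign d else 0 := by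
    rw [Finsupp.linearCombination_apply, Finsupp.sum_fintype _ _ (by simp)]
    simp only [regionImage, Finsupp.coe_finsetSum, Finset.sum_apply, Finsupp.smul_apply,
      Finsupp.single_apply, smul_eq_mul, Finset.mul_sum]
    simp only [Finset.sum_filter]
    rw [Finset.sum_comm]
    refine Finset.sum_congr rfl fun d _ => ?_
    rw [Finset.sum_ite_eq Finset.univ (region d)]
    simp
  rw [h1, sum_dart, Finset.sum_eq_single v]
  · simp only [if_true, cornerSign_zero, cornerSign_one, cornerSign_two, cornerSign_three,
      cornerSum]
    ring
  · intro w _ hw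
    simp [hw]
  · simp

/-- Extension by zero of a function on all curves but one. -/
noncomputable def extendCurve {b : H.Curve} (c : {c : H.Curve // c ≠ b} →₀ ℝ) (x : H.Curve) : ℝ :=
  if h : x ≠ b then c ⟨x, h⟩ else 0

lemma linearCombination_curveImage {b : H.Curve} (c : {c : H.Curve // c ≠ b} →₀ ℝ)
    (v : H.Vertex) :
    Finsupp.linearCombination ℝ (fun c : {c : H.Curve // c ≠ b} => H.curveImage c.1) c v =
      extendCurve c (alphaCurve v) + extendCurve c (betaCurve v) := by
  have h1 : ∀ x : H.Curve, H.curveImage x v =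
      (if alphaCurve v = x then 1 else 0) + (if betaCurve v = x then 1 else 0) := by
    intro x
    simp only [curveImage, Finsupp.coe_finsetSum, Finset.sum_apply, Finsupp.single_apply]
    rw [Finset.sum_filter, Finset.sum_eq_single v]
    · by_cases h : alphaCurve v = x
      · have h' : betaCurve v ≠ x := fun h' => alphaCurve_ne_betaCurve v v (h.trans h'.symm)
        simp [h, h']
      · simp [h]
    · intro w _ hw
      simp [hw]
    · simp
  have h2 : ∀ y : H.Curve, ∑ x : {c : H.Curve // c ≠ b}, c x * (if y = x.1 then 1 else 0) =
      extendCurve c y := by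
    intro y
    by_cases hy : y = b
    · rw [extendCurve, dif_neg (not_not.2 hy)]
      refine Finset.sum_eq_zero fun x _ => ?_
      rw [if_neg (fun h => x.2 (h.symm.trans hy)), mul_zero]
    · rw [extendCurve, dif_pos hy, Finset.sum_eq_single ⟨y, hy⟩]
      · simp
      · intro x _ hx
        rw [if_neg (fun h => hx (Subtype.ext h.symm)), mul_zero]
      · simp
  rw [Finsupp.linearCombination_apply, Finsupp.sum_fintype _ _ (by simp)]
  simp only [Finsupp.coe_finsetSum, Finset.sum_apply, Finsupp.smul_apply, smul_eq_mul, h1,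
    mul_add, Finset.sum_add_distrib, h2]

lemma vertexMap_apply {b : H.Curve} (f : H.Region →₀ ℝ) (c : {c : H.Curve // c ≠ b} →₀ ℝ)
    (v : H.Vertex) :
    H.vertexMap b (f, c) v =
      cornerSum f v + (extendCurve c (alphaCurve v) + extendCurve c (betaCurve v)) := by
  rw [vertexMap, LinearMap.coprod_apply, Finsupp.add_apply, linearCombination_regionImage,
    linearCombination_curveImage]

/-- If the alternating corner sums of a function on the regions are a sum over curves, then the
curves have opposite coefficients where they meet. -/
lemma add_eq_zero_of_cornerSum_add {r : H.Region → ℝ} {c : H.Curve → ℝ}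
    (h : ∀ v, cornerSum r v + (c (alphaCurve v) + c (betaCurve v)) = 0) (v : H.Vertex) :
    c (alphaCurve v) + c (betaCurve v) = 0 := by
  -- Sign and coefficient agree at both ends of an edge while the jump is odd, so edges cancel. The
  -- contribution of a vertex is `(c α + c β) * cornerSum`, which by `h` is minus a square.
  have h0 : ∑ d : H.Dart, H.cornerSign d * c (curve d) * jump r d = 0 :=
    sum_eq_zero_of_edge_neg fun d => by rw [cornerSign_edge, curve_edge, jump_edge]; ring
  rw [sum_dart] at h0
  have h1 : ∑ v : H.Vertex, (c (alphaCurve v) + c (betaCurve v)) ^ 2 = 0 := by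
    rw [← neg_eq_zero, ← h0, ← Finset.sum_neg_distrib]
    refine Finset.sum_congr rfl fun w _ => ?_
    have e2 : c (curve ((w, 2) : H.Dart)) = c (alphaCurve w) := congrArg c (curve_opp (w, 0))
    have e3 : c (curve ((w, 3) : H.Dart)) = c (betaCurve w) := congrArg c (curve_opp (w, 1))
    have e0 : c (curve ((w, 0) : H.Dart)) = c (alphaCurve w) := rfl
    have e1 : c (curve ((w, 1) : H.Dart)) = c (betaCurve w) := rfl
    rw [cornerSign_zero, cornerSign_one, cornerSign_two, cornerSign_three, e0, e1, e2, e3]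
    linear_combination -c (alphaCurve w) * jump_zero_add_jump_two r w +
      c (betaCurve w) * jump_one_add_jump_three r w -
      (c (alphaCurve w) + c (betaCurve w)) * h w
  have h2 := (Finset.sum_eq_zero_iff_of_nonneg (fun w _ => sq_nonneg _)).1 h1 v (Finset.mem_univ v)
  exact pow_eq_zero_iff two_ne_zero |>.1 h2

/-- Rotating at a vertex alternates between its two curves, whose coefficients vanish together;
connectedness spreads the zero from `b`. -/
lemma curve_eq_zero {c : H.Curve → ℝ} (h : ∀ v, c (alphaCurve v) + c (betaCurve v) = 0)
    {b : H.Curve} (hb : c b = 0) (x : H.Curve) : c x = 0 := by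
  obtain ⟨d, rfl⟩ : ∃ d : H.Dart, curve d = x := Quot.mk_surjective x
  obtain ⟨d', rfl⟩ : ∃ d : H.Dart, curve d = b := Quot.mk_surjective b
  refine dart_induction (p := fun d => c (curve d) = 0) (fun d hd => by rwa [curve_edge]) ?_ _ _ hb
  intro v k
  have hv := h v
  by_cases hk : H.IsAlphaDart (v, k)
  · rw [curve_of_isAlphaDart hk,
      curve_of_not_isAlphaDart (fun hk' => (isAlphaDart_add_one v k).1 hk' hk)]
    constructor <;> intro <;> linarith
  · rw [curve_of_not_isAlphaDart hk, curve_of_isAlphaDart ((isAlphaDart_add_one v k).2 hk)]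
    constructor <;> intro <;> linarith

lemma mem_ker_vertexMap {b : H.Curve}
    {x : (H.Region →₀ ℝ) × ({c : H.Curve // c ≠ b} →₀ ℝ)} :
    x ∈ LinearMap.ker (H.vertexMap b) ↔ ⇑x.1 ∈ H.periodicDomains ∧ x.2 = 0 := by
  obtain ⟨f, c⟩ := x
  rw [LinearMap.mem_ker, Finsupp.ext_iff]
  simp only [vertexMap_apply, Finsupp.coe_zero, Pi.zero_apply]
  constructor
  · intro h
    have h1 := add_eq_zero_of_cornerSum_add h
    refine ⟨fun v => ?_, ?_⟩
    · have := h v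
      rw [h1 v] at this
      simpa using this
    · have h2 : extendCurve c b = 0 := dif_neg (not_not.2 rfl)
      ext x
      have h3 := curve_eq_zero h1 h2 x.1
      rwa [extendCurve, dif_pos x.2] at h3
  · rintro ⟨h, rfl⟩ v
    have h3 : ∀ x, extendCurve (0 : {c : H.Curve // c ≠ b} →₀ ℝ) x = 0 := fun x => by
      simp [extendCurve]
    rw [h v, h3, h3]
    simp

lemma finrank_ker_vertexMap_le (b : H.Curve) :
    Module.finrank ℝ (LinearMap.ker (H.vertexMap b)) ≤ Module.finrank ℝ H.periodicDomains := by
  let L : LinearMap.ker (H.vertexMap b) →ₗ[ℝ] H.periodicDomains :=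
    { toFun x := ⟨⇑x.1.1, (mem_ker_vertexMap.1 x.2).1⟩
      map_add' x y := rfl
      map_smul' t x := rfl }
  refine LinearMap.finrank_le_finrank_of_injective (f := L) ?_
  intro x y h
  refine Subtype.ext (Prod.ext (DFunLike.coe_injective (congrArg Subtype.val h)) ?_)
  rw [(mem_ker_vertexMap.1 x.2).2, (mem_ker_vertexMap.1 y.2).2]

/-! ### The domains at the base points -/

lemma alphaComponent_region_sub_one {d : H.Dart} (h : ¬ H.IsAlphaDart d) :
    alphaComponent (region (H := H) (d.1, d.2 - 1)) = alphaComponent (region d) :=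
  (Quot.sound (r := fun r r' : H.Region => ∃ d : H.Dart, ¬ H.IsAlphaDart d ∧
    r = region d ∧ r' = region (H := H) (d.1, d.2 - 1)) ⟨d, h, rfl, rfl⟩).symm

lemma betaComponent_region_sub_one {d : H.Dart} (h : H.IsAlphaDart d) :
    betaComponent (region (H := H) (d.1, d.2 - 1)) = betaComponent (region d) :=
  (Quot.sound (r := fun r r' : H.Region => ∃ d : H.Dart, H.IsAlphaDart d ∧
    r = region d ∧ r' = region (H := H) (d.1, d.2 - 1)) ⟨d, h, rfl, rfl⟩).symm

lemma alphaDomain_apply (r s : H.Region) :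
    H.alphaDomain r s = if alphaComponent s = alphaComponent r then 1 else 0 := by
  simp only [alphaDomain, Finsupp.coe_finsetSum, Finset.sum_apply, Finsupp.single_apply]
  rw [Finset.sum_filter, Finset.sum_eq_single s]
  · simp
  · intro w _ hw
    simp [hw]
  · simp

lemma betaDomain_apply (r s : H.Region) :
    H.betaDomain r s = if betaComponent s = betaComponent r then 1 else 0 := by
  simp only [betaDomain, Finsupp.coe_finsetSum, Finset.sum_apply, Finsupp.single_apply]
  rw [Finset.sum_filter, Finset.sum_eq_single s]
  · simp
  · intro w _ hw
    simp [hw]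
  · simp

/-- The corners on the two sides of a `β` dart lie in the same component of `Σ ∖ α`, so the
alternating sum cancels in pairs. -/
lemma alphaDomain_mem_periodicDomains (r : H.Region) :
    ⇑(H.alphaDomain r) ∈ H.periodicDomains := fun v => by
  have h1 := alphaComponent_region_sub_one (not_isAlphaDart_one v)
  have h3 := alphaComponent_region_sub_one (not_isAlphaDart_three v)
  have e1 : (1 - 1 : ZMod 4) = 0 := by decide
  have e3 : (3 - 1 : ZMod 4) = 2 := by decide
  simp only [e1, e3] at h1 h3
  simp only [cornerSum, alphaDomain_apply, h1, h3]
  ring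

lemma betaDomain_mem_periodicDomains (r : H.Region) :
    ⇑(H.betaDomain r) ∈ H.periodicDomains := fun v => by
  have h0 := betaComponent_region_sub_one (isAlphaDart_zero v)
  have h2 := betaComponent_region_sub_one (isAlphaDart_two v)
  have e0 : (0 - 1 : ZMod 4) = 3 := by decide
  have e2 : (2 - 1 : ZMod 4) = 1 := by decide
  simp only [e0, e2] at h0 h2
  simp only [cornerSum, betaDomain_apply, h0, h2]
  ring

/-- A function on the regions that is constant on the components of `Σ ∖ α` and on the components
of `Σ ∖ β` is constant. -/
lemma eq_const_of_components {r : H.Region → ℝ}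
    (ha : ∀ s t, alphaComponent s = alphaComponent t → r s = r t)
    (hb : ∀ s t, betaComponent s = betaComponent t → r s = r t) (s t : H.Region) : r s = r t := by
  refine eq_const_of_jump_eq_zero (fun d => sub_eq_zero.2 ?_) s t
  by_cases hd : H.IsAlphaDart d
  · exact (hb _ _ (betaComponent_region_sub_one hd)).symm
  · exact (ha _ _ (alphaComponent_region_sub_one hd)).symm

/-- In a relation `a + b = 0`, the `α` part `a = -b` is constant on both kinds of components, hence
constant. It vanishes at the last base point, whose `β` domain is left out. Evaluation at the base
points then reads off every coefficient. -/
lemma linearIndependent_domains {m : ℕ} {z : Fin (m + 1) → H.Region} (hz : H.IsBasepoints z) :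
    LinearIndependent ℝ (Sum.elim (fun i : Fin (m + 1) => H.alphaDomain (z i))
      (fun j : Fin m => H.betaDomain (z j.castSucc))) := by
  rw [Fintype.linearIndependent_iff]
  intro g hg
  let a : H.Region → ℝ := fun s => ∑ i, g (Sum.inl i) * H.alphaDomain (z i) s
  let b : H.Region → ℝ := fun s => ∑ j, g (Sum.inr j) * H.betaDomain (z (Fin.castSucc j)) s
  have hab : ∀ s, a s + b s = 0 := fun s => by
    have := DFunLike.congr_fun hg s
    simpa [a, b, Fintype.sum_sum_type, Finsupp.coe_finsetSum] using this
  have haz : ∀ i, a (z i) = g (Sum.inl i) := fun i => by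
    simp only [a, alphaDomain_apply, hz.1.injective.eq_iff]
    simp
  have hbz : ∀ i : Fin (m + 1), b (z i) = ∑ j, g (Sum.inr j) * if i = Fin.castSucc j then 1 else 0 :=
      fun i => by
    simp only [b, betaDomain_apply, hz.2.injective.eq_iff]
  have hconst : ∀ s t, a s = a t := eq_const_of_components
    (fun s t h => by simp only [a, alphaDomain_apply, h])
    (fun s t h => by
      have : b s = b t := by simp only [b, betaDomain_apply, h]
      have h1 := hab s
      have h2 := hab t
      linarith)
  have hlast : a (z (Fin.last m)) = 0 := by
    have h1 : b (z (Fin.last m)) = 0 := by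
      rw [hbz]
      refine Finset.sum_eq_zero fun j _ => ?_
      rw [if_neg (Fin.castSucc_lt_last j).ne', mul_zero]
    have := hab (z (Fin.last m))
    linarith
  have ha : ∀ s, a s = 0 := fun s => (hconst s _).trans hlast
  rintro (i | j)
  · rw [← haz, ha]
  · have h1 := hab (z j.castSucc)
    rw [ha, hbz] at h1
    simpa using h1

/-- The statement on the linear map for a diagram whose periodic domains and curves are counted
correctly. -/
lemma vertexMap_surjective_and_ker {m : ℕ}
    (hP : Module.finrank ℝ H.periodicDomains ≤ 2 * m + 1)
    (hC : (2 * m + 2 : ℤ) ≤ H.eulerChar + Fintype.card H.Curve)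
    {z : Fin (m + 1) → H.Region} (hz : H.IsBasepoints z) (b : H.Curve) :
    Function.Surjective (H.vertexMap b) ∧
      LinearMap.ker (H.vertexMap b) =
        Submodule.span ℝ
          (Set.range (fun i : Fin (m + 1) =>
              ((H.alphaDomain (z i), 0) :
                (H.Region →₀ ℝ) × ({c : H.Curve // c ≠ b} →₀ ℝ))) ∪
            Set.range (fun j : Fin m =>
              ((H.betaDomain (z j.castSucc), 0) :
                (H.Region →₀ ℝ) × ({c : H.Curve // c ≠ b} →₀ ℝ)))) := by
  have hker : Module.finrank ℝ (LinearMap.ker (H.vertexMap b)) ≤ 2 * m + 1 :=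
    (finrank_ker_vertexMap_le b).trans hP
  constructor
  -- The source has dimension `χ + verts + (#curves - 1)`, the `-1` being the omitted curve.
  -- Subtracting at most `2m + 1` for the kernel leaves at least `verts`.
  · rw [← LinearMap.range_eq_top]
    refine Submodule.eq_top_of_finrank_eq (le_antisymm (Submodule.finrank_le _) ?_)
    have h1 := LinearMap.finrank_range_add_finrank_ker (H.vertexMap b)
    have h2 : Fintype.card {c : H.Curve // c ≠ b} = Fintype.card H.Curve - 1 := by
      rw [Fintype.card_subtype_compl, Fintype.card_subtype_eq]
    have h3 : 0 < Fintype.card H.Curve := Fintype.card_pos_iff.2 ⟨b⟩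
    rw [Module.finrank_prod, Module.finrank_finsupp_self, Module.finrank_finsupp_self, h2] at h1
    rw [Module.finrank_finsupp_self, Fintype.card_fin]
    rw [eulerChar, Nat.card_eq_fintype_card] at hC
    omega
  · symm
    rw [← Set.Sum.elim_range]
    refine Submodule.eq_of_le_of_finrank_le ?_ ?_
    · rw [Submodule.span_le]
      rintro _ ⟨i | j, rfl⟩
      · exact mem_ker_vertexMap.2 ⟨alphaDomain_mem_periodicDomains _, rfl⟩
      · exact mem_ker_vertexMap.2 ⟨betaDomain_mem_periodicDomains _, rfl⟩
    -- The `(m + 1) + m` independent vectors already reach the upper bound for the kernel.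
    · have hli := (linearIndependent_domains hz).map'
        (LinearMap.inl ℝ (H.Region →₀ ℝ) ({c : H.Curve // c ≠ b} →₀ ℝ))
        (LinearMap.ker_eq_bot.2 LinearMap.inl_injective)
      rw [Sum.comp_elim] at hli
      refine hker.trans (le_of_eq ?_)
      refine Eq.trans ?_ (finrank_span_eq_card hli).symm
      simp only [Fintype.card_sum, Fintype.card_fin]
      omega

variable {H' : CurveDiagram}

/-! ### Braid diagrams -/

lemma exists_curve_eq (c : H.Curve) : ∃ v, alphaCurve v = c ∨ betaCurve v = c := by
  obtain ⟨d, rfl⟩ : ∃ d : H.Dart, curve d = c := Quot.mk_surjective c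
  by_cases h : H.IsAlphaDart d
  · exact ⟨d.1, Or.inl (curve_of_isAlphaDart h).symm⟩
  · exact ⟨d.1, Or.inr (curve_of_not_isAlphaDart h).symm⟩

lemma IsBraidDiagram.card_curve {m : ℕ} (h : H.IsBraidDiagram m) :
    Fintype.card H.Curve = 2 * m := by
  obtain ⟨-, x, z, ha, hb, -⟩ := h
  have hbij : Function.Bijective
      (Sum.elim (fun i : Fin m => alphaCurve (x i)) (fun i : Fin m => betaCurve (x i))) := by
    constructor
    · rintro (i | i) (j | j) hij
      · exact congrArg Sum.inl ((ha (x i)).unique rfl hij)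
      · exact absurd hij (alphaCurve_ne_betaCurve _ _)
      · exact absurd hij.symm (alphaCurve_ne_betaCurve _ _)
      · exact congrArg Sum.inr ((hb (x i)).unique rfl hij)
    · intro c
      obtain ⟨v, rfl | rfl⟩ := exists_curve_eq c
      · obtain ⟨i, hi, -⟩ := ha v
        exact ⟨Sum.inl i, hi.symm⟩
      · obtain ⟨i, hi, -⟩ := hb v
        exact ⟨Sum.inr i, hi.symm⟩
  rw [← Fintype.card_of_bijective hbij, Fintype.card_sum, Fintype.card_fin]
  ring

lemma nonempty_vertex_of_eulerChar_ne_zero (h : H.eulerChar ≠ 0) : Nonempty H.Vertex := by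
  by_contra hV
  rw [not_nonempty_iff] at hV
  have hR : IsEmpty H.Region := ⟨fun r => by
    obtain ⟨d, -⟩ := region_surjective r
    exact hV.elim d.1⟩
  have hv : H.verts = 0 := (Fintype.card_fin H.verts).symm.trans (Fintype.card_eq_zero_iff.2 hV)
  refine h ?_
  rw [eulerChar, hv, Nat.card_of_isEmpty]
  rfl

/-! ### Erasing vertices -/

lemma Trace.curve_eq {S : Set H.Vertex} {d x : H.Dart} (h : H.Trace S d x) :
    curve x = curve d := by
  induction h with
  | edge => exact curve_edge d
  | through x _ _ ih => rw [curve_edge, curve_opp, ih]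

/-- Tracing is deterministic, so the end outside `S` is the first exit of an orbit. -/
lemma Trace.exists_iterate {S : Set H.Vertex} {d x : H.Dart} (h : H.Trace S d x) :
    ∃ k : ℕ, x = (fun y => H.edge (opp y))^[k] (H.edge d) ∧
      ∀ j < k, ((fun y => H.edge (opp y))^[j] (H.edge d)).1 ∈ S := by
  induction h with
  | edge => exact ⟨0, rfl, fun j hj => absurd hj (Nat.not_lt_zero j)⟩
  | through x _ hx ih =>
    obtain ⟨k, rfl, hk⟩ := ih
    refine ⟨k + 1, by rw [Function.iterate_succ_apply'], fun j hj => ?_⟩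
    rcases Nat.lt_succ_iff_lt_or_eq.1 hj with hj | rfl
    · exact hk j hj
    · exact hx

/-- The end of a trace is unique. -/
lemma Trace.eq_of_notMem {S : Set H.Vertex} {d x y : H.Dart} (hx : H.Trace S d x)
    (hy : H.Trace S d y) (hxS : x.1 ∉ S) (hyS : y.1 ∉ S) : x = y := by
  obtain ⟨k, rfl, hk⟩ := hx.exists_iterate
  obtain ⟨l, rfl, hl⟩ := hy.exists_iterate
  rcases lt_trichotomy k l with h | rfl | h
  · exact absurd (hl k h) hxS
  · rfl
  · exact absurd (hk l h) hyS

section Erasure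

variable {ι : H.Vertex → H'.Vertex}

lemma IsErasure.curve_map_eq (hι : IsErasure H H' ι) {d d' : H.Dart} (h : curve d = curve d') :
    curve (H := H') (ι d.1, d.2) = curve (H := H') (ι d'.1, d'.2) := by
  refine of_curve_eq (p := fun x : H.Dart =>
    curve (H := H') (ι d.1, d.2) = curve (H := H') (ι x.1, x.2)) ?_ ?_ h rfl
  · intro x hx
    exact hx.trans (hι.2 x).curve_eq.symm
  · intro x hx
    exact hx.trans (curve_opp (H := H') (ι x.1, x.2)).symm

/-- Erasing does not merge curves: the traces from the kept darts of one old curve fill up a whole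
new curve, and their kept darts all come from that old curve. -/
lemma IsErasure.curve_eq_of_map (hι : IsErasure H H' ι) {d d' : H.Dart}
    (h : curve (H := H') (ι d.1, d.2) = curve (H := H') (ι d'.1, d'.2)) :
    curve d = curve d' := by
  have hmem : ∀ v, ι v ∉ (Set.range ι)ᶜ := fun v hv => hv ⟨v, rfl⟩
  have hinj : ∀ x y : H.Dart, ((ι x.1, x.2) : H'.Dart) = (ι y.1, y.2) → x = y := fun x y hxy => by
    rw [Prod.mk.injEq] at hxy
    exact Prod.ext (hι.1 hxy.1) hxy.2
  -- `x` lies on such a trace, either as the arriving or as the departing end of one of its edges.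
  let p : H'.Dart → Prop := fun x => ∃ e : H.Dart, curve e = curve d ∧
    (H'.Trace (Set.range ι)ᶜ (ι e.1, e.2) x ∨ H'.Trace (Set.range ι)ᶜ (ι e.1, e.2) (H'.edge x))
  have hself : ∀ e : H.Dart, curve e = curve d → p (ι e.1, e.2) := fun e he =>
    ⟨e, he, Or.inr Trace.edge⟩
  have hedge : ∀ x, p x → p (H'.edge x) := by
    rintro x ⟨e, he, hx⟩
    exact ⟨e, he, by rw [H'.edge_edge]; exact hx.symm⟩
  have hdep : ∀ (e : H.Dart) (y : H'.Dart), H'.Trace (Set.range ι)ᶜ (ι e.1, e.2) (H'.edge y) →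
      y = (ι e.1, e.2) ∨ ((opp y).1 ∈ (Set.range ι)ᶜ ∧
        H'.Trace (Set.range ι)ᶜ (ι e.1, e.2) (opp y)) := by
    intro e y hy
    generalize hw : H'.edge y = w at hy
    cases hy with
    | edge => exact Or.inl (by rw [← H'.edge_edge y, hw, H'.edge_edge])
    | through x hx hxS =>
      have : y = opp x := by rw [← H'.edge_edge y, hw, H'.edge_edge]
      rw [this, opp_opp]
      exact Or.inr ⟨hxS, hx⟩
  have hopp : ∀ x, p x → p (opp x) := by
    rintro x ⟨e, he, hx | hx⟩
    · by_cases hxS : x.1 ∈ (Set.range ι)ᶜ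
      · exact ⟨e, he, Or.inr (Trace.through x hx hxS)⟩
      · rw [hx.eq_of_notMem (hι.2 e) hxS (hmem _)]
        exact hself (opp (H.edge e)) (by rw [curve_opp, curve_edge, he])
    · rcases hdep e x hx with rfl | ⟨-, h1⟩
      · exact hself (opp e) (by rw [curve_opp, he])
      · exact ⟨e, he, Or.inl h1⟩
  obtain ⟨e, he, h1 | h1⟩ := of_curve_eq hedge hopp h (hself d rfl)
  · rw [← he, hinj _ _ (h1.eq_of_notMem (hι.2 e) (hmem _) (hmem _)), curve_edge]
  · rcases hdep e _ h1 with h2 | ⟨h2, -⟩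
    · rw [hinj _ _ h2, he]
    · exact absurd h2 (hmem _)

/-- The map on curves that is induced by an erasure. -/
noncomputable def IsErasure.curveMap (_hι : IsErasure H H' ι) (c : H.Curve) : H'.Curve :=
  curve (ι (Quot.out c).1, (Quot.out c).2)

lemma IsErasure.curveMap_curve (hι : IsErasure H H' ι) (d : H.Dart) :
    hι.curveMap (curve d) = curve (H := H') (ι d.1, d.2) :=
  hι.curve_map_eq (Quot.out_eq (curve d))

lemma IsErasure.curveMap_injective (hι : IsErasure H H' ι) :
    Function.Injective hι.curveMap := fun c c' h => by
  have := hι.curve_eq_of_map h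
  rwa [show curve (Quot.out c) = c from Quot.out_eq c,
    show curve (Quot.out c') = c' from Quot.out_eq c'] at this

/-- Restrict to the kept corners: `h` makes the values constant along each boundary walk of `H`, so
that they descend to regions, and `hinj` makes the restriction injective. -/
lemma finrank_periodicDomains_le_of_erasure
    (h : ∀ r ∈ H'.periodicDomains, ∀ d : H.Dart,
      r (region (H := H') (ι (H.edge d).1, (H.edge d).2 - 1)) = r (region (H := H') (ι d.1, d.2)))
    (hinj : ∀ r ∈ H'.periodicDomains,
      (∀ d : H.Dart, r (region (H := H') (ι d.1, d.2)) = 0) → ∀ s, r s = 0) :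
    Module.finrank ℝ H'.periodicDomains ≤ Module.finrank ℝ H.periodicDomains := by
  let f : (r : H'.Region → ℝ) → r ∈ H'.periodicDomains → H.Region → ℝ := fun r hr =>
    Quot.lift (fun d : H.Dart => r (region (H := H') (ι d.1, d.2))) (by
      rintro d _ rfl
      exact (h r hr d).symm)
  let L : H'.periodicDomains →ₗ[ℝ] H.periodicDomains :=
    { toFun r := ⟨f r.1 r.2, fun v => r.2 (ι v)⟩
      map_add' r s := by
        ext t
        obtain ⟨d, rfl⟩ := region_surjective t
        rfl
      map_smul' c r := by
        ext t
        obtain ⟨d, rfl⟩ := region_surjective t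
        rfl }
  refine LinearMap.finrank_le_finrank_of_injective (f := L) ?_
  rw [← LinearMap.ker_eq_bot, LinearMap.ker_eq_bot']
  intro r hr
  ext s
  exact hinj r.1 r.2 (fun d => congrFun (congrArg Subtype.val hr) (region d)) s

/-- If a periodic domain vanishes at the remaining corners, then it has no jump along the curves
through remaining vertices. -/
lemma jump_eq_zero_of_mem_range {r : H'.Region → ℝ}
    (h : ∀ d : H.Dart, r (region (H := H') (ι d.1, d.2)) = 0) (u : H.Vertex) (k : ZMod 4) :
    jump r (ι u, k) = 0 := by
  rw [jump, h (u, k), h (u, k - 1), sub_zero]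

/-! ### Stabilizations -/

lemma edge_eq_opp_of_existsUnique {v : H.Vertex}
    (h : ∀ w, betaCurve w = betaCurve v → w = v) : H.edge (v, 1) = (v, 3) := by
  have h1 : ¬ H.IsAlphaDart (H.edge (v, 1)) := by
    rw [isAlphaDart_edge]
    exact not_isAlphaDart_one v
  have h2 : (H.edge (v, 1)).1 = v := h _ (by
    rw [← curve_of_not_isAlphaDart h1, curve_edge]
    rfl)
  have h3 : (H.edge (v, 1)).2 ≠ 1 := fun h3 => H.edge_ne (v, 1) (Prod.ext h2 h3)
  refine Prod.ext h2 ?_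
  simp only [IsAlphaDart] at h1
  change (H.edge (v, 1)).2 = 3
  generalize (H.edge (v, 1)).2 = k at h1 h3
  revert k
  decide

/-- A curve that meets only one other curve, in a single vertex, forces the jump along the other
curve to vanish. -/
lemma jump_eq_zero_of_belt {r : H.Region → ℝ} {v : H.Vertex}
    (h : ∀ w, betaCurve w = betaCurve v → w = v) : jump r (v, 2) = 0 := by
  have h1 := region_edge ((v, 3) : H.Dart)
  rw [← edge_eq_opp_of_existsUnique h, H.edge_edge] at h1
  rw [edge_eq_opp_of_existsUnique h] at h1
  have e1 : (3 - 1 : ZMod 4) = 2 := by decide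
  have e2 : (2 - 1 : ZMod 4) = 1 := by decide
  simp only [e1] at h1
  simp only [jump, e2, h1, sub_self]

/-- If a function has no jump along an `α` curve, nor along the other curves that meet it away
from a single vertex, then it has no jump along the curve that meets it in that vertex. -/
lemma jump_eq_zero_of_dual {r : H.Region → ℝ} {v : H.Vertex}
    (ha : ∀ d, curve d = alphaCurve v → jump r d = 0)
    (hb : ∀ w, alphaCurve w = alphaCurve v → w ≠ v → jump r (w, 1) = 0 ∧ jump r (w, 3) = 0) :
    jump r (v, 1) = 0 := by
  -- A parity count replaces walking once around the `α` curve. The marked darts pair up along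
  -- edges, and away from `v` also across vertices; so `(v, 2)` is marked because `(v, 0)` is.
  let g : H.Dart → ZMod 2 := fun d =>
    if curve d = alphaCurve v ∧ r (region d) = r (region (v, 0)) then 1 else 0
  have hself : ∀ t : ZMod 2, t + t = 0 := by decide
  have hg : ∀ d, g (H.edge d) = g d := fun d => by
    simp only [g, curve_edge]
    refine if_congr (and_congr_right fun hd => ?_) rfl rfl
    rw [region_edge, ← sub_eq_zero.1 (ha d hd)]
  have h1 : ∑ d, g d = 0 := by
    refine Finset.sum_involution (fun d _ => H.edge d) (fun d _ => by rw [hg, hself])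
      (fun d _ _ => H.edge_ne d) (fun _ _ => Finset.mem_univ _) (fun d _ => H.edge_edge d)
  have hg0 : ∀ w (k : ZMod 4), ¬ H.IsAlphaDart (w, k) → g (w, k) = 0 := fun w k hk =>
    if_neg fun h => by
      have := (isAlphaDart_iff_of_curve_eq h.1).2 (isAlphaDart_zero v)
      exact hk this
  have e1 : (1 - 1 : ZMod 4) = 0 := by decide
  have e2 : (2 - 1 : ZMod 4) = 1 := by decide
  have e3 : (3 - 1 : ZMod 4) = 2 := by decide
  have hw : ∀ w, w ≠ v → g (w, 0) = g (w, 2) := fun w hwv => by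
    have hc : curve ((w, 2) : H.Dart) = alphaCurve w := curve_opp (w, 0)
    have hc0 : curve ((w, 0) : H.Dart) = alphaCurve w := rfl
    simp only [g, hc, hc0]
    refine if_congr (and_congr_right fun hd => ?_) rfl rfl
    have h2 := ha (w, 2) (hc.trans hd)
    have h3 := (hb w hd hwv).1
    simp only [jump, e1, e2] at h2 h3
    rw [sub_eq_zero.1 h2, sub_eq_zero.1 h3]
  have h2 : ∑ d, g d = g (v, 0) + g (v, 2) := by
    have hsum : ∀ w, ∑ k, g (w, k) = g (w, 0) + g (w, 2) := fun w => by
      have : ∑ k, g (w, k) = g (w, 0) + g (w, 1) + g (w, 2) + g (w, 3) :=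
        Fin.sum_univ_four (fun k : Fin 4 => g (w, k))
      rw [this, hg0 w 1 (not_isAlphaDart_one w), hg0 w 3 (not_isAlphaDart_three w), add_zero,
        add_zero]
    rw [Fintype.sum_prod_type, Finset.sum_eq_single v]
    · exact hsum v
    · intro w _ hwv
      rw [hsum, hw w hwv, hself]
    · simp
  have h3 : g (v, 0) = 1 := if_pos ⟨rfl, rfl⟩
  rw [h1, h3] at h2
  have h4 : r (region (v, 2)) = r (region (v, 0)) := by
    by_contra hne
    have : g (v, 2) = 0 := if_neg fun h => hne h.2
    rw [this] at h2
    exact absurd h2 (by decide)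
  have h5 := ha (v, 2) (curve_opp (v, 0))
  simp only [jump, e2] at h5
  simp only [jump, e1]
  linarith

lemma IsStabilization.finrank_periodicDomains_le (h : IsStabilization H H') [hV : Nonempty H.Vertex] :
    Module.finrank ℝ H'.periodicDomains ≤ Module.finrank ℝ H.periodicDomains := by
  obtain ⟨-, a, b, ι, ⟨v, rfl, hv⟩, hba, hι, hrange, hbeta⟩ := h
  obtain rfl := hba v rfl
  have hja : ∀ r ∈ H'.periodicDomains, ∀ d, curve d = alphaCurve v → jump r d = 0 :=
    fun r hr d hd => jump_eq_zero_of_curve_eq hr (d := (v, 2)) ((curve_opp (v, 0)).trans hd.symm)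
      (jump_eq_zero_of_belt hv)
  refine finrank_periodicDomains_le_of_erasure (ι := ι) ?_ ?_
  · intro r hr d
    -- The value on the left of the trace stays the same: a trace from a kept vertex can pass a
    -- forgotten one only along a `β` curve, crossing the new `α` curve, which carries no jump.
    have key : ∀ x, H'.Trace (Set.range ι)ᶜ (ι d.1, d.2) x →
        r (region (H'.edge x)) = r (region (H := H') (ι d.1, d.2)) := by
      intro x hx
      induction hx with
      | edge => rw [H'.edge_edge]
      | through x hx hxS ih =>
        rw [← ih, H'.edge_edge, region_edge]
        have hxa : alphaCurve x.1 = alphaCurve v := by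
          by_contra hne
          exact hxS ((hrange _).2 hne)
        have hxβ : ¬ H'.IsAlphaDart x := fun hxα => by
          have h1 := hx.curve_eq
          have h2 := (isAlphaDart_iff_of_curve_eq h1).1 hxα
          rw [curve_of_isAlphaDart hxα, curve_of_isAlphaDart h2] at h1
          exact (hrange (ι d.1)).1 ⟨_, rfl⟩ (h1.symm.trans hxa)
        have hα : H'.IsAlphaDart (x.1, x.2 - 1) := by
          by_contra hn
          rw [← isAlphaDart_add_one, sub_add_cancel] at hn
          exact hxβ hn
        have h3 := hja r hr (x.1, x.2 - 1) ((curve_of_isAlphaDart hα).trans hxa)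
        have e : x.2 - 1 - 1 = x.2 + 2 := by
          generalize x.2 = k
          revert k
          decide
        simp only [jump, e] at h3
        exact (sub_eq_zero.1 h3).symm
    have := key _ (hι.2 d)
    rwa [region_edge] at this
  · intro r hr h0 s
    -- Only the belt escapes this argument, since it has no kept vertex; its jump is killed by going
    -- around the new `α` curve, which it meets once.
    have hold : ∀ d, curve d ≠ betaCurve v → jump r d = 0 := by
      intro d hd
      by_cases hdα : H'.IsAlphaDart d
      · by_cases hda : alphaCurve d.1 = alphaCurve v
        · exact hja r hr d ((curve_of_isAlphaDart hdα).trans hda)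
        · obtain ⟨u, hu⟩ := (hrange d.1).2 hda
          have := jump_eq_zero_of_mem_range h0 u d.2
          rwa [hu] at this
      · rw [curve_of_not_isAlphaDart hdα] at hd
        obtain ⟨u, hu⟩ := (hbeta d.1).resolve_left hd
        refine jump_eq_zero_of_curve_eq hr (d := (ι u, 1)) ?_ (jump_eq_zero_of_mem_range h0 u 1)
        rw [curve_of_not_isAlphaDart hdα, ← hu]
        rfl
    have hb : jump r (v, 1) = 0 := by
      refine jump_eq_zero_of_dual (hja r hr) fun w _ hwv => ?_
      have hne : betaCurve w ≠ betaCurve v := fun h => hwv (hv w h)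
      refine ⟨hold (w, 1) hne, hold (w, 3) ?_⟩
      rwa [curve_of_not_isAlphaDart (not_isAlphaDart_three w)]
    obtain ⟨u⟩ := hV
    rw [← h0 (u, 0)]
    refine eq_const_of_jump_eq_zero (fun d => ?_) _ _
    by_cases hd : curve d = betaCurve v
    · exact jump_eq_zero_of_curve_eq hr (d := (v, 1)) hd.symm hb
    · exact hold d hd

/-- The images of the old curves are distinct and differ from both new ones: kept vertices lie off
the new `α` curve, and the only vertex of the belt lies on it. -/
lemma IsStabilization.card_curve_le (h : IsStabilization H H') :
    Fintype.card H.Curve + 2 ≤ Fintype.card H'.Curve := by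
  obtain ⟨-, a, b, ι, ⟨v, rfl, hv⟩, hba, hι, hrange, hbeta⟩ := h
  obtain rfl := hba v rfl
  let f : H.Curve ⊕ Bool → H'.Curve :=
    Sum.elim hι.curveMap (fun t => if t then alphaCurve v else betaCurve v)
  have h1 : ∀ c, hι.curveMap c ≠ alphaCurve v ∧ hι.curveMap c ≠ betaCurve v := by
    intro c
    obtain ⟨u, rfl | rfl⟩ := exists_curve_eq c
    · exact ⟨fun h => (hrange (ι u)).1 ⟨u, rfl⟩ ((hι.curveMap_curve (u, 0)).symm.trans h),
        fun h => alphaCurve_ne_betaCurve (ι u) v ((hι.curveMap_curve (u, 0)).symm.trans h)⟩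
    · exact ⟨fun h => alphaCurve_ne_betaCurve v (ι u) (((hι.curveMap_curve (u, 1)).symm.trans h).symm),
        fun h => (hrange (ι u)).1 ⟨u, rfl⟩ (hba _ ((hι.curveMap_curve (u, 1)).symm.trans h))⟩
  have hf : Function.Injective f := by
    rw [Sum.elim_injective]
    refine ⟨hι.curveMap_injective, ?_, ?_⟩
    · rintro (_ | _) (_ | _) h
      · rfl
      · exact absurd h.symm (alphaCurve_ne_betaCurve v v)
      · exact absurd h (alphaCurve_ne_betaCurve v v)
      · rfl
    · rintro c (_ | _)
      · exact (h1 c).2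
      · exact (h1 c).1
  simpa using Fintype.card_le_of_injective f hf

/-! ### Finger moves -/

section Bigon

variable {p q : H.Vertex} {k l : ZMod 4}

/-- The darts of the two edges of a bigon with corners `(p, k)` and `(q, l)`. -/
def IsBigonDart (p q : H.Vertex) (k l : ZMod 4) (d : H.Dart) : Prop :=
  (d.1 = p ∧ (d.2 = k ∨ d.2 = k + 1)) ∨ (d.1 = q ∧ (d.2 = l ∨ d.2 = l + 1))

lemma edge_of_nextCorner (h : H.nextCorner (p, k) = (q, l)) : H.edge (p, k) = (q, l + 1) := by
  simp only [nextCorner, Prod.mk.injEq] at h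
  exact Prod.ext h.1 (sub_eq_iff_eq_add.1 h.2)

lemma isBigonDart_edge (h₁ : H.nextCorner (p, k) = (q, l)) (h₂ : H.nextCorner (q, l) = (p, k))
    {d : H.Dart} (hd : IsBigonDart p q k l d) : IsBigonDart p q k l (H.edge d) := by
  have e₁ := edge_of_nextCorner h₁
  have e₂ := edge_of_nextCorner h₂
  obtain ⟨w, j⟩ := d
  simp only [IsBigonDart] at hd
  rcases hd with ⟨rfl, rfl | rfl⟩ | ⟨rfl, rfl | rfl⟩
  · rw [e₁]
    exact Or.inr ⟨rfl, Or.inr rfl⟩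
  · rw [← e₂, H.edge_edge]
    exact Or.inr ⟨rfl, Or.inl rfl⟩
  · rw [e₂]
    exact Or.inl ⟨rfl, Or.inr rfl⟩
  · rw [← e₁, H.edge_edge]
    exact Or.inl ⟨rfl, Or.inl rfl⟩

lemma region_bigon (h₁ : H.nextCorner (p, k) = (q, l)) :
    region (H := H) (p, k) = region (q, l) ∧
      region (H := H) (p, k + 3) = region (q, l + 1) := by
  have e₁ := edge_of_nextCorner h₁
  constructor
  · rw [← h₁]
    exact (region_nextCorner (p, k)).symm
  · rw [← e₁, region_edge]
    have : ∀ j : ZMod 4, j + 3 = j - 1 := by decide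
    rw [this]

/-- A periodic domain takes the same values at the corners opposite to the corners of a bigon. -/
lemma region_bigon_opp {r : H.Region → ℝ} (hr : r ∈ H.periodicDomains)
    (h₁ : H.nextCorner (p, k) = (q, l)) (h₂ : H.nextCorner (q, l) = (p, k)) :
    r (region (p, k + 2)) = r (region (q, l + 2)) := by
  have hs : ∀ (v : H.Vertex) (j : ZMod 4), r (region (v, j + 2)) =
      r (region (v, j + 1)) + r (region (v, j + 3)) - r (region (v, j)) := fun v j => by
    have h := jump_opp hr (v, j)
    have e1 : j + 2 - 1 = j + 1 := by ring
    have e2 : ∀ i : ZMod 4, i - 1 = i + 3 := by decide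
    simp only [jump, opp, e1, e2 j] at h
    linarith
  rw [hs p k, hs q l, (region_bigon h₁).1, (region_bigon h₁).2, (region_bigon h₂).2]
  ring

/-- Past a bigon, the value of a periodic domain on the left of a curve is the same as before. -/
lemma region_opp_bigonDart {r : H.Region → ℝ} (hr : r ∈ H.periodicDomains)
    (h₁ : H.nextCorner (p, k) = (q, l)) (h₂ : H.nextCorner (q, l) = (p, k))
    {d : H.Dart} (hd : IsBigonDart p q k l d) :
    r (region (opp d)) = r (region (H.edge (opp (H.edge d)))) := by
  have e₁ := edge_of_nextCorner h₁
  have e₂ := edge_of_nextCorner h₂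
  have s2 : ∀ j : ZMod 4, j + 2 - 1 = j + 1 := by decide
  have s3 : ∀ j : ZMod 4, j + 1 + 2 - 1 = j + 2 := by decide
  have s4 : ∀ j : ZMod 4, j + 1 + 2 = j + 3 := by decide
  obtain ⟨w, j⟩ := d
  simp only [IsBigonDart] at hd
  rcases hd with ⟨rfl, rfl | rfl⟩ | ⟨rfl, rfl | rfl⟩
  · rw [e₁, region_edge]
    simp only [opp, s3]
    exact region_bigon_opp hr h₁ h₂
  · rw [← e₂, H.edge_edge, region_edge, e₂]
    simp only [opp, s2, s4]
    rw [(region_bigon h₁).2]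
  · rw [e₂, region_edge]
    simp only [opp, s3]
    exact region_bigon_opp hr h₂ h₁
  · rw [← e₁, H.edge_edge, region_edge, e₁]
    simp only [opp, s2, s4]
    rw [(region_bigon h₂).2]

lemma isBigonDart_opp_iff (hpq : p ≠ q) {d : H.Dart} (hd : d.1 = p ∨ d.1 = q) :
    IsBigonDart p q k l (opp d) ↔ ¬ IsBigonDart p q k l d := by
  have key : ∀ j k : ZMod 4, (j + 2 = k ∨ j + 2 = k + 1) ↔ ¬ (j = k ∨ j = k + 1) := by decide
  rcases hd with hd | hd
  · simp only [IsBigonDart, opp, hd, key, hpq, true_and, false_and, or_false]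
  · simp only [IsBigonDart, opp, hd, key, hpq.symm, true_and, false_and, false_or]

end Bigon

lemma IsFingerMove.finrank_periodicDomains_le (h : IsFingerMove H H') [hV : Nonempty H.Vertex] :
    Module.finrank ℝ H'.periodicDomains ≤ Module.finrank ℝ H.periodicDomains := by
  obtain ⟨-, p, q, ι, hpq, ⟨k, l, h₁, h₂⟩, hι, hrange, hα, hβ⟩ := h
  have hS : ∀ w, w ∉ Set.range ι ↔ w = p ∨ w = q := fun w => by
    rw [hrange]
    tauto
  have hedge : ∀ d, IsBigonDart p q k l d ↔ IsBigonDart p q k l (H'.edge d) := fun d =>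
    ⟨isBigonDart_edge h₁ h₂, fun hd => by
      simpa only [H'.edge_edge] using isBigonDart_edge h₁ h₂ hd⟩
  have hkept : ∀ u j, ¬ IsBigonDart p q k l ((ι u, j) : H'.Dart) := fun u j hd =>
    (hS (ι u)).2 (hd.imp And.left And.left) ⟨u, rfl⟩
  refine finrank_periodicDomains_le_of_erasure (ι := ι) ?_ ?_
  · intro r hr d
    -- The left value may change while the trace runs along an edge of the bigon, so there it is
    -- read off from the edge before. Passing `p` or `q` switches between bigon and other edges, and
    -- after the bigon the left value is restored.
    have key : ∀ x, H'.Trace (Set.range ι)ᶜ (ι d.1, d.2) x →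
        r (region (if IsBigonDart p q k l x then H'.edge (opp (H'.edge x)) else H'.edge x)) =
          r (region (H := H') (ι d.1, d.2)) := by
      intro x hx
      induction hx with
      | edge => rw [if_neg (by rw [← hedge]; exact hkept _ _), H'.edge_edge]
      | through x hx hxS ih =>
        have hiff := isBigonDart_opp_iff (k := k) (l := l) hpq ((hS x.1).1 hxS)
        by_cases hB : IsBigonDart p q k l x
        · rw [if_pos hB] at ih
          rw [if_neg (by rw [← hedge, hiff]; exact not_not.2 hB), H'.edge_edge,
            region_opp_bigonDart hr h₁ h₂ hB, ih]
        · rw [if_neg hB] at ih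
          rw [if_pos (by rw [← hedge, hiff]; exact hB), H'.edge_edge, opp_opp, ih]
    have := key _ (hι.2 d)
    rwa [if_neg (hkept _ _), region_edge] at this
  · intro r hr h0 s
    obtain ⟨u⟩ := hV
    rw [← h0 (u, 0)]
    refine eq_const_of_jump_eq_zero (fun d => ?_) _ _
    by_cases hd : H'.IsAlphaDart d
    · obtain ⟨w, hw⟩ := hα d.1
      exact jump_eq_zero_of_curve_eq hr (hw.trans (curve_of_isAlphaDart hd).symm)
        (jump_eq_zero_of_mem_range h0 w 0)
    · obtain ⟨w, hw⟩ := hβ d.1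
      exact jump_eq_zero_of_curve_eq hr (hw.trans (curve_of_not_isAlphaDart hd).symm)
        (jump_eq_zero_of_mem_range h0 w 1)

lemma IsFingerMove.card_curve_le (h : IsFingerMove H H') :
    Fintype.card H.Curve ≤ Fintype.card H'.Curve := by
  obtain ⟨-, p, q, ι, -, -, hι, -⟩ := h
  exact Fintype.card_le_of_injective _ hι.curveMap_injective

end Erasure

/-! ### Induction over the moves and conclusion -/

/-- A braid diagram has `2m` curves and `χ = 2`, which gives both bounds. A vertex is carried along
because injectivity of the restriction needs a kept corner; the first one exists since the empty
diagram has `χ = 0`. -/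
lemma IsStabilizedBraidDiagram.counts {m : ℕ} (h : IsStabilizedBraidDiagram m H) :
    Nonempty H.Vertex ∧ Module.finrank ℝ H.periodicDomains ≤ 2 * m + 1 ∧
      (2 * m + 2 : ℤ) ≤ H.eulerChar + Fintype.card H.Curve := by
  induction h with
  | braid H hH =>
    refine ⟨nonempty_vertex_of_eulerChar_ne_zero (by rw [hH.1]; norm_num), ?_, ?_⟩
    · rw [← hH.card_curve]
      exact H.finrank_periodicDomains_le
    · rw [hH.1, hH.card_curve]
      push_cast
      linarith
  | stabilization H H' _ hs ih =>
    obtain ⟨hV, hP, hC⟩ := ih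
    have hcard := hs.card_curve_le
    refine ⟨?_, hs.finrank_periodicDomains_le.trans hP, ?_⟩
    · obtain ⟨-, a, b, ι, -⟩ := hs
      exact hV.map ι
    · rw [hs.1]
      omega
  | fingerMove H H' _ hs ih =>
    obtain ⟨hV, hP, hC⟩ := ih
    have hcard := hs.card_curve_le
    refine ⟨?_, hs.finrank_periodicDomains_le.trans hP, ?_⟩
    · obtain ⟨-, p, q, ι, -⟩ := hs
      exact hV.map ι
    · rw [hs.1]
      omega

end CurveDiagram

theorem lemma4p2 (m : ℕ) (H : CurveDiagram)
    (hH : CurveDiagram.IsStabilizedBraidDiagram m H)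
    (z : Fin (m + 1) → H.Region) (hz : H.IsBasepoints z)
    (b : H.Curve) (hb : H.IsBeta b) :
    Function.Surjective (H.vertexMap b) ∧
      LinearMap.ker (H.vertexMap b) =
        Submodule.span ℝ
          (Set.range (fun i : Fin (m + 1) =>
              ((H.alphaDomain (z i), 0) :
                (H.Region →₀ ℝ) × ({c : H.Curve // c ≠ b} →₀ ℝ))) ∪
            Set.range (fun j : Fin m =>
              ((H.betaDomain (z j.castSucc), 0) :
                (H.Region →₀ ℝ) × ({c : H.Curve // c ≠ b} →₀ ℝ)))) := by
  obtain ⟨-, hP, hC⟩ := hH.counts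
  exact CurveDiagram.vertexMap_surjective_and_ker hP hC hz b
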